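/- Let $n>1$ be an integer, let $\phi:\mathbb{R}^n\to\mathbb{R}$ be twice continuously differentiable with $M$-Lipschitz continuous Hessian (with respect to the Euclidean and spectral norms), where $M>0$, and let $f:\mathbb{R}^n\to\mathbb{R}$ be a measurable function with $|f(y)-\phi(y)|\le\epsilon_f$ for all $y\in\mathbb{R}^n$, where $\epsilon_f\ge 0$. Let $x\in\mathbb{R}^n$, $0<\theta<1$, $0<\delta<1$, $\sigma>0$, let $u_1,\dots,u_N$ be independent random vectors with the standard Gaussian distribution $\mathcal{N}(0,I)$ on $\mathbb{R}^n$, and let $$g(x)=\frac{1}{2N}\sum_{i=1}^N\frac{f(x+\sigma u_i)-f(x-\sigma u_i)}{\sigma}\,u_i$$ be the central Gaussian smoothed gradient estimate. Suppose that $$N\ \ge\ \frac{3n}{\delta\theta^2}\,\frac{n}{(\sqrt n-1)^2}+\frac{n+6}{144\,\delta}+\frac{1}{6\delta},$$ $$\sqrt[3]{\frac{\epsilon_f}{\sqrt n\,M}}\ \le\ \sigma\ \le\ \sqrt{\frac{\theta\|\nabla\phi(x)\|}{12\,n^{3/2}M}},\qquad \|\nabla\phi(x)\|\ \ge\ \frac{12\sqrt[3]{n^{7/2}M\epsilon_f^2}}{\theta}.$$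 Then, with probability at least $1-\delta$, the norm condition $$\|g(x)-\nabla\phi(x)\|\le\theta\,\|\nabla\phi(x)\|$$ holds. -/

import Mathlib

open MeasureTheory ProbabilityTheory

noncomputable section

/-- Bounded noise: `f` is a (possibly noisy) evaluation of `φ`, and the noise `f - φ` is
bounded by `εf` in absolute value, uniformly on `ℝⁿ`. -/
def BoundedNoise {n : ℕ} (f φ : EuclideanSpace ℝ (Fin n) → ℝ) (εf : ℝ) : Prop :=
  0 ≤ εf ∧ ∀ y, |f y - φ y| ≤ εf

/-- The Hessian of `φ` at `x`, as the second derivative: the bilinear form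
`(v, w) ↦ vᵀ ∇²φ(x) w`. Its operator norm is the spectral norm of the Hessian matrix. -/
def hessian {n : ℕ} (φ : EuclideanSpace ℝ (Fin n) → ℝ) (x : EuclideanSpace ℝ (Fin n)) :
    EuclideanSpace ℝ (Fin n) →L[ℝ] EuclideanSpace ℝ (Fin n) →L[ℝ] ℝ :=
  fderiv ℝ (fderiv ℝ φ) x

/-- `φ` is twice continuously differentiable and its Hessian is `M`-Lipschitz continuous
on `ℝⁿ`. -/
def HasLipschitzHessian {n : ℕ} (φ : EuclideanSpace ℝ (Fin n) → ℝ) (M : ℝ) : Prop :=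
  ContDiff ℝ 2 φ ∧ ∀ x y, ‖hessian φ x - hessian φ y‖ ≤ M * ‖x - y‖

/-- The central Gaussian smoothed gradient estimate of `f` at `x` with sampling radius `σ` and
sampling directions `u 1, …, u N`:
`g(x) = 1/(2N) ∑ᵢ ((f(x + σ uᵢ) - f(x - σ uᵢ)) / σ) uᵢ`. -/
def centralGSG {n N : ℕ} (f : EuclideanSpace ℝ (Fin n) → ℝ) (σ : ℝ)
    (u : Fin N → EuclideanSpace ℝ (Fin n)) (x : EuclideanSpace ℝ (Fin n)) :
    EuclideanSpace ℝ (Fin n) :=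
  (1 / (2 * (N : ℝ))) • ∑ i, ((f (x + σ • u i) - f (x - σ • u i)) / σ) • u i

/-- The norm condition `‖g - ∇φ(x)‖ ≤ θ ‖∇φ(x)‖` for a gradient estimate `g` at `x`. -/
def NormCondition {n : ℕ} (φ : EuclideanSpace ℝ (Fin n) → ℝ) (θ : ℝ)
    (x g : EuclideanSpace ℝ (Fin n)) : Prop :=
  ‖g - gradient φ x‖ ≤ θ * ‖gradient φ x‖

end

/-! Write `a` for the gradient at `x`. The estimate is a sample mean of vectors `(⟪a, u⟫ + ρ u) •
u`. In a central difference the second-order Taylor term cancels, so the Lipschitz Hessian and the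
noise bound give `|ρ u| ≤ c‖u‖³ + e` with `c = Mσ²/6` and `e = εf/σ`.

The linear part has mean exactly `a`. The bias is thus the mean of `ρ u • u`, whose norm is at most
the L² norm of `ρ`, without a dimension factor (`norm_integral_smul_self_sq_le`). The variance is at
most `2(n+1)‖a‖²` plus a remainder controlled by `c` and `e`, by the fourth moments of the Gaussian
and bounds on moments of its norm.

The two bounds on `σ` make `c` and `e` small against `θ‖a‖`: the bias takes a tenth of the tolerance
`θ‖a‖`, and Chebyshev's inequality on the other nine tenths has failure probability at most `δ` once
`Nδθ² ≥ 3(n+1)`. -/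

open scoped RealInnerProductSpace

/-! ### Moments of the standard Gaussian. -/

section GaussianMoments

open scoped Nat

/-- The even moments of the standard normal distribution. -/
theorem integral_pow_two_mul_gaussianReal (k : ℕ) :
    ∫ x, x ^ (2 * k) ∂(gaussianReal 0 1) = ((2 * k - 1 : ℕ)‼ : ℝ) := by
  rw [integral_gaussianReal_eq_integral_smul one_ne_zero]
  have h1 : ∀ x : ℝ, gaussianPDFReal 0 1 x • x ^ (2 * k) =
      (fun y : ℝ => (Real.sqrt (2 * Real.pi))⁻¹ *
        (y ^ ((2 * k : ℕ) : ℝ) * Real.exp (-(1 / 2) * y ^ (2 : ℝ)))) |x| := by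
    intro x
    simp only [gaussianPDFReal_def, smul_eq_mul, Real.rpow_natCast, Real.rpow_two, sq_abs,
      NNReal.coe_one, mul_one, sub_zero]
    rw [pow_mul |x|, sq_abs, ← pow_mul, mul_assoc, mul_comm (x ^ (2 * k))]
    congr 3
    ring
  simp_rw [h1]
  rw [integral_comp_abs (f := fun y : ℝ => (Real.sqrt (2 * Real.pi))⁻¹ *
        (y ^ ((2 * k : ℕ) : ℝ) * Real.exp (-(1 / 2) * y ^ (2 : ℝ)))), integral_const_mul,
    integral_rpow_mul_exp_neg_mul_rpow two_pos (by
      have : (0 : ℝ) ≤ ((2 * k : ℕ) : ℝ) := Nat.cast_nonneg _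
      linarith) (by norm_num)]
  have h2 : (((2 * k : ℕ) : ℝ) + 1) / 2 = k + 1 / 2 := by push_cast; ring
  rw [neg_div, h2, Real.Gamma_nat_add_half, Real.rpow_neg (by norm_num),
    Real.rpow_add (by norm_num), Real.rpow_natCast, ← Real.sqrt_eq_rpow,
    Real.sqrt_mul (by norm_num), Real.sqrt_div (by norm_num), Real.sqrt_one]
  have hpi : Real.sqrt Real.pi ≠ 0 := (Real.sqrt_pos.2 Real.pi_pos).ne'
  have h2s : Real.sqrt 2 ≠ 0 := (Real.sqrt_pos.2 two_pos).ne'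
  have hk : ((1 : ℝ) / 2) ^ k = 1 / 2 ^ k := by rw [div_pow, one_pow]
  rw [hk]
  field_simp

variable {E : Type*} [NormedAddCommGroup E] [InnerProductSpace ℝ E] [FiniteDimensional ℝ E]
  [MeasurableSpace E] [BorelSpace E]

theorem map_inner_stdGaussian (c : E) :
    (stdGaussian E).map (fun u => ⟪c, u⟫) = (gaussianReal 0 1).map (fun x => ‖c‖ * x) := by
  have h := IsGaussian.map_eq_gaussianReal (μ := stdGaussian E) (innerSL ℝ c)
  rw [integral_strongDual_stdGaussian, variance_dual_stdGaussian, innerSL_apply_norm] at h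
  rw [gaussianReal_map_const_mul, mul_zero, mul_one]
  convert! h using 2
  ext
  simp

theorem integral_inner_pow_stdGaussian (c : E) (k : ℕ) :
    ∫ u, ⟪c, u⟫ ^ (2 * k) ∂(stdGaussian E) = ((2 * k - 1 : ℕ)‼ : ℝ) * ‖c‖ ^ (2 * k) := by
  have h := integral_map (μ := stdGaussian E) (f := fun x : ℝ => x ^ (2 * k))
    (show AEMeasurable (fun u => ⟪c, u⟫) _ from Measurable.aemeasurable (by fun_prop))
    (by fun_prop)
  rw [← h, map_inner_stdGaussian, integral_map (by fun_prop) (by fun_prop)]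
  simp_rw [mul_pow]
  rw [integral_const_mul, integral_pow_two_mul_gaussianReal, mul_comm]

theorem integrable_norm_pow_stdGaussian (k : ℕ) :
    Integrable (fun u : E => ‖u‖ ^ k) (stdGaussian E) :=
  (IsGaussian.memLp_id (stdGaussian E) k (by simp)).integrable_norm_pow'

theorem integrable_of_abs_le_norm_pow {F : E → ℝ} (hF : Measurable F) (C : ℝ) (k : ℕ)
    (h : ∀ u, |F u| ≤ C * (1 + ‖u‖ ^ k)) : Integrable F (stdGaussian E) :=
  (((integrable_const (1 : ℝ)).add (integrable_norm_pow_stdGaussian k)).const_mul C).mono'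
    hF.aestronglyMeasurable (.of_forall h)

theorem integrable_inner_pow_stdGaussian (c : E) (k : ℕ) :
    Integrable (fun u : E => ⟪c, u⟫ ^ k) (stdGaussian E) := by
  refine integrable_of_abs_le_norm_pow (Measurable.pow_const (by fun_prop) _) (‖c‖ ^ k) k
    fun u => ?_
  rw [abs_pow]
  calc |⟪c, u⟫| ^ k ≤ (‖c‖ * ‖u‖) ^ k := by gcongr; exact abs_real_inner_le_norm c u
    _ ≤ _ := by rw [mul_pow]; gcongr; linarith

theorem integral_inner_mul_inner_stdGaussian (a b : E) :
    ∫ u, ⟪a, u⟫ * ⟪b, u⟫ ∂(stdGaussian E) = ⟪a, b⟫ := by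
  have h : ∀ u : E, ⟪a, u⟫ * ⟪b, u⟫ =
      (1 / 4) * (⟪a + b, u⟫ ^ (2 * 1) - ⟪a - b, u⟫ ^ (2 * 1)) := by
    intro u
    rw [inner_add_left, inner_sub_left]
    ring
  simp_rw [h]
  rw [integral_const_mul, integral_sub (integrable_inner_pow_stdGaussian _ _)
    (integrable_inner_pow_stdGaussian _ _), integral_inner_pow_stdGaussian,
    integral_inner_pow_stdGaussian]
  simp only [mul_one, norm_add_sq_real, norm_sub_sq_real]
  norm_num [Nat.doubleFactorial]
  ring

theorem integrable_inner_sq_mul_inner_sq_stdGaussian (a b : E) :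
    Integrable (fun u : E => ⟪a, u⟫ ^ 2 * ⟪b, u⟫ ^ 2) (stdGaussian E) := by
  refine integrable_of_abs_le_norm_pow (by fun_prop) (‖a‖ ^ 2 * ‖b‖ ^ 2) 4 fun u => ?_
  rw [abs_mul, abs_pow, abs_pow]
  calc |⟪a, u⟫| ^ 2 * |⟪b, u⟫| ^ 2 ≤ (‖a‖ * ‖u‖) ^ 2 * (‖b‖ * ‖u‖) ^ 2 := by
        gcongr <;> exact abs_real_inner_le_norm _ u
    _ = ‖a‖ ^ 2 * ‖b‖ ^ 2 * ‖u‖ ^ 4 := by ring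
    _ ≤ _ := by gcongr; linarith

theorem integral_inner_sq_mul_inner_sq_stdGaussian (a b : E) :
    ∫ u, ⟪a, u⟫ ^ 2 * ⟪b, u⟫ ^ 2 ∂(stdGaussian E) = ‖a‖ ^ 2 * ‖b‖ ^ 2 + 2 * ⟪a, b⟫ ^ 2 := by
  -- Quartic polarization: mixed fourth moments reduce to fourth powers of single linear forms.
  have h : ∀ u : E, ⟪a, u⟫ ^ 2 * ⟪b, u⟫ ^ 2 =
      (1 / 12) * (⟪a + b, u⟫ ^ (2 * 2) + ⟪a - b, u⟫ ^ (2 * 2)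
        - 2 * (⟪a, u⟫ ^ (2 * 2) + ⟪b, u⟫ ^ (2 * 2))) := by
    intro u
    rw [inner_add_left, inner_sub_left]
    ring
  have hi := fun c : E => integrable_inner_pow_stdGaussian c (2 * 2)
  simp_rw [h]
  rw [integral_const_mul, integral_sub ((hi (a + b)).fun_add (hi (a - b)))
    (((hi a).fun_add (hi b)).const_mul 2), integral_const_mul, integral_add (hi _) (hi _), integral_add (hi _) (hi _)]
  simp only [integral_inner_pow_stdGaussian]
  simp only [pow_mul, norm_add_sq_real, norm_sub_sq_real]
  norm_num [Nat.doubleFactorial]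
  ring

theorem integral_inner_sq_mul_norm_sq_stdGaussian (a : E) :
    ∫ u, ⟪a, u⟫ ^ 2 * ‖u‖ ^ 2 ∂(stdGaussian E) = (Module.finrank ℝ E + 2) * ‖a‖ ^ 2 := by
  let b := stdOrthonormalBasis ℝ E
  simp_rw [← b.sum_sq_inner_right, Finset.mul_sum]
  rw [integral_finsetSum _ fun i _ => integrable_inner_sq_mul_inner_sq_stdGaussian a (b i)]
  simp_rw [integral_inner_sq_mul_inner_sq_stdGaussian, Finset.sum_add_distrib, ← Finset.mul_sum,
    b.sum_sq_inner_left, b.sum_sq_inner_right]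
  simp
  ring

/-- The power mean inequality over the coordinates reduces this to one-dimensional moments. The
constant is not sharp, but the order in the dimension is. -/
theorem integral_norm_pow_stdGaussian_le (k : ℕ) :
    ∫ u, ‖u‖ ^ (2 * (k + 1)) ∂(stdGaussian E) ≤
      (Module.finrank ℝ E : ℝ) ^ (k + 1) * ((2 * k + 1 : ℕ)‼ : ℝ) := by
  let b := stdOrthonormalBasis ℝ E
  have h : ∀ u : E, ‖u‖ ^ (2 * (k + 1)) ≤
      (Module.finrank ℝ E : ℝ) ^ k * ∑ i, ⟪b i, u⟫ ^ (2 * (k + 1)) := by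
    intro u
    rw [pow_mul, ← b.sum_sq_inner_right]
    have h2 := pow_sum_div_card_le_sum_pow (s := Finset.univ) (f := fun i => ⟪b i, u⟫ ^ 2)
      (fun _ _ => sq_nonneg _) k
    simp_rw [pow_mul]
    rcases (Module.finrank ℝ E).eq_zero_or_pos with h0 | h0
    · have : IsEmpty (Fin (Module.finrank ℝ E)) := by rw [h0]; infer_instance
      simp
    · rw [div_le_iff₀ (by simpa using pow_pos (Nat.cast_pos.2 h0) k)] at h2
      simpa [mul_comm] using h2
  refine (integral_mono (integrable_norm_pow_stdGaussian _) (Integrable.const_mul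
    (integrable_finsetSum _ fun i _ => integrable_inner_pow_stdGaussian (b i) _) _) h).trans_eq ?_
  rw [integral_const_mul, integral_finsetSum _
    fun i _ => integrable_inner_pow_stdGaussian (b i) _]
  simp only [integral_inner_pow_stdGaussian, b.norm_eq_one, one_pow, mul_one, Finset.sum_const,
    Finset.card_univ, Fintype.card_fin, nsmul_eq_mul, show 2 * (k + 1) - 1 = 2 * k + 1 by omega]
  ring

end GaussianMoments

/-! ### Third-order error of the central difference. -/

section Taylor

variable {E : Type*} [NormedAddCommGroup E] [NormedSpace ℝ E]

/-- Along `t ↦ x ± t w` the second derivative of the error is a difference of Hessians at points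
`2t‖w‖` apart, so at most `2M‖w‖³t`. Two integrations, each a comparison of derivatives, turn this
into `M‖w‖³t²` and then `M‖w‖³t³/3`. -/
theorem abs_central_difference_sub_le {φ : E → ℝ} {M : ℝ} (hφ : ContDiff ℝ 2 φ)
    (hM : ∀ x y, ‖fderiv ℝ (fderiv ℝ φ) x - fderiv ℝ (fderiv ℝ φ) y‖ ≤ M * ‖x - y‖) (x w : E) :
    |φ (x + w) - φ (x - w) - 2 * fderiv ℝ φ x w| ≤ M * ‖w‖ ^ 3 / 3 := by
  have hd : Differentiable ℝ φ := hφ.differentiable (by norm_num)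
  have hd' : Differentiable ℝ (fderiv ℝ φ) :=
    (hφ.fderiv_right (m := 1) (by norm_num)).differentiable (by norm_num)
  have hl : ∀ (s t : ℝ), HasDerivAt (fun t : ℝ => x + (s * t) • w) (s • w) t := by
    intro s t
    simpa using (((hasDerivAt_id t).const_mul s).smul_const w).const_add x
  have h1 : ∀ s t : ℝ, HasDerivAt (fun t : ℝ => φ (x + (s * t) • w))
      (s * fderiv ℝ φ (x + (s * t) • w) w) t := by
    intro s t
    simpa [Function.comp_def] using ((hd _).hasFDerivAt.comp_hasDerivAt t (hl s t))
  have h2 : ∀ s t : ℝ, HasDerivAt (fun t : ℝ => fderiv ℝ φ (x + (s * t) • w) w)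
      (s * fderiv ℝ (fderiv ℝ φ) (x + (s * t) • w) w w) t := by
    intro s t
    simpa using ((hd' _).hasFDerivAt.comp_hasDerivAt t (hl s t)).clm_apply (hasDerivAt_const t w)
  have hψ' : ∀ t : ℝ, HasDerivAt (fun t : ℝ => fderiv ℝ φ (x + (1 * t) • w) w
      + fderiv ℝ φ (x + (-1 * t) • w) w - 2 * fderiv ℝ φ x w)
      (fderiv ℝ (fderiv ℝ φ) (x + (1 * t) • w) w w
        - fderiv ℝ (fderiv ℝ φ) (x + (-1 * t) • w) w w) t := by
    intro t
    have := ((h2 1 t).add (h2 (-1) t)).sub_const (2 * fderiv ℝ φ x w)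
    convert! this using 1
    ring
  have hψ : ∀ t : ℝ, HasDerivAt (fun t : ℝ => φ (x + (1 * t) • w)
      - φ (x + (-1 * t) • w) - 2 * fderiv ℝ φ x w * t)
      (fderiv ℝ φ (x + (1 * t) • w) w
      + fderiv ℝ φ (x + (-1 * t) • w) w - 2 * fderiv ℝ φ x w) t := by
    intro t
    have := ((h1 1 t).sub (h1 (-1) t)).sub ((hasDerivAt_id t).const_mul (2 * fderiv ℝ φ x w))
    convert! this using 1
    ring
  have hB' : ∀ t : ℝ, HasDerivAt (fun t : ℝ => M * ‖w‖ ^ 3 * t ^ 2)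
      (2 * M * ‖w‖ ^ 3 * t) t := by
    intro t
    convert! (hasDerivAt_pow 2 t).const_mul (M * ‖w‖ ^ 3) using 1
    simp; ring
  have hB : ∀ t : ℝ, HasDerivAt (fun t : ℝ => M * ‖w‖ ^ 3 / 3 * t ^ 3)
      (M * ‖w‖ ^ 3 * t ^ 2) t := by
    intro t
    convert! (hasDerivAt_pow 3 t).const_mul (M * ‖w‖ ^ 3 / 3) using 1
    simp; ring
  have key' := image_norm_le_of_norm_deriv_right_le_deriv_boundary (a := 0) (b := 1)
    (fun t _ => (hψ' t).continuousAt.continuousWithinAt) (fun t _ => (hψ' t).hasDerivWithinAt)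
    (by simp; ring) hB' (fun t ht => by
      rw [← sub_apply, ← sub_apply]
      calc _ ≤ ‖fderiv ℝ (fderiv ℝ φ) (x + (1 * t) • w)
              - fderiv ℝ (fderiv ℝ φ) (x + (-1 * t) • w)‖ * ‖w‖ * ‖w‖ :=
            ContinuousLinearMap.le_opNorm₂ _ _ _
        _ ≤ M * ‖(x + (1 * t) • w) - (x + (-1 * t) • w)‖ * ‖w‖ * ‖w‖ := by gcongr; exact hM _ _
        _ = _ := by
          have : (x + (1 * t) • w) - (x + (-1 * t) • w) = (2 * t) • w := by module
          rw [this, norm_smul, Real.norm_of_nonneg (by linarith [ht.1])]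
          ring)
  have key := image_norm_le_of_norm_deriv_right_le_deriv_boundary (a := 0) (b := 1)
    (fun t _ => (hψ t).continuousAt.continuousWithinAt) (fun t _ => (hψ t).hasDerivWithinAt)
    (by simp) hB (fun t ht => key' ⟨ht.1, ht.2.le⟩) (x := 1) (by simp)
  simpa [sub_eq_add_neg] using key

end Taylor

/-! ### Independent samples: variance of the mean and Chebyshev's inequality. -/

theorem memLp_comp_of_hasLaw {S Ω F : Type*} [MeasurableSpace S] [MeasurableSpace Ω]
    [NormedAddCommGroup F] {γ : Measure S} {P : Measure Ω} {X : Ω → S} (hX : HasLaw X γ P)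
    {h : S → F} {p : ENNReal} (hh : MemLp h p γ) : MemLp (fun ω => h (X ω)) p P := by
  rw [← hX.map_eq] at hh
  exact hh.comp_of_map hX.aemeasurable

theorem integrable_norm_sub_sq {S E : Type*} [NormedAddCommGroup E] [MeasurableSpace S] {γ : Measure S}
    [IsFiniteMeasure γ] {h : S → E} (hL2 : MemLp h 2 γ) (a : E) :
    Integrable (fun s => ‖h s - a‖ ^ 2) γ :=
  (memLp_two_iff_integrable_sq_norm (hL2.1.sub aestronglyMeasurable_const)).1
    (hL2.sub (memLp_const a))

theorem memLp_sum_sub_of_hasLaw {S Ω F : Type*} [MeasurableSpace S] [MeasurableSpace Ω]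
    [NormedAddCommGroup F] {γ : Measure S} {P : Measure Ω} [IsFiniteMeasure P] {N : ℕ}
    {u : Fin N → Ω → S} (hu : ∀ i, HasLaw (u i) γ P)
    {h : S → F} {p : ENNReal} (hh : MemLp h p γ) (v : F) :
    MemLp (fun ω => ∑ i, h (u i ω) - v) p P := by
  have h1 : MemLp (fun ω => ∑ i, h (u i ω)) p P :=
    memLp_finsetSum Finset.univ fun i _ => memLp_comp_of_hasLaw (hu i) hh
  exact h1.sub (memLp_const v)

section SampleMean

variable {E : Type*} [NormedAddCommGroup E] [InnerProductSpace ℝ E] [FiniteDimensional ℝ E]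
  [MeasurableSpace E] [BorelSpace E]

/-- The mean squared deviation of a sum of independent copies from its mean is at most the sum of
the mean squared deviations of the copies from an arbitrary point. -/
theorem integral_norm_sum_sub_sq_le {S Ω : Type*} [MeasurableSpace S] [MeasurableSpace Ω]
    {γ : Measure S} [IsProbabilityMeasure γ] {P : Measure Ω} [IsProbabilityMeasure P] {N : ℕ}
    {u : Fin N → Ω → S} (hu : ∀ i, HasLaw (u i) γ P) (hind : iIndepFun u P)
    {h : S → E} (hm : Measurable h) (hL2 : MemLp h 2 γ) (a : E) :
    ∫ ω, ‖∑ i, h (u i ω) - (N : ℝ) • ∫ s, h s ∂γ‖ ^ 2 ∂P ≤ N * ∫ s, ‖h s - a‖ ^ 2 ∂γ := by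
  let b := stdOrthonormalBasis ℝ E
  have hint : Integrable h γ := hL2.integrable (by norm_num)
  have hc : ∀ j, MemLp (fun s => ⟪b j, h s⟫) 2 γ := fun j => hL2.const_inner (b j)
  have hcu : ∀ i j, MemLp (fun ω => ⟪b j, h (u i ω)⟫) 2 P :=
    fun i j => memLp_comp_of_hasLaw (hu i) (hc j)
  have hmean : ∀ i j, ∫ ω, ⟪b j, h (u i ω)⟫ ∂P = ⟪b j, ∫ s, h s ∂γ⟫ := by
    intro i j
    rw [← integral_inner hint]
    exact (hu i).integral_comp (f := fun s => ⟪b j, h s⟫) (hc j).1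
  have hvar : ∀ j, ∫ ω, ⟪b j, ∑ i, h (u i ω) - (N : ℝ) • ∫ s, h s ∂γ⟫ ^ 2 ∂P ≤
      N * ∫ s, ⟪b j, h s - a⟫ ^ 2 ∂γ := by
    intro j
    have h1 : ∫ ω, ⟪b j, ∑ i, h (u i ω) - (N : ℝ) • ∫ s, h s ∂γ⟫ ^ 2 ∂P
        = Var[∑ i, fun ω => ⟪b j, h (u i ω)⟫; P] := by
      rw [variance_eq_integral (Finset.aemeasurable_sum _ fun i _ => (hcu i j).1.aemeasurable)]
      simp only [Finset.sum_apply]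
      rw [integral_finsetSum _ fun i _ => (hcu i j).integrable (by norm_num)]
      simp only [hmean, inner_sub_right, inner_sum, inner_smul_right, Finset.sum_const,
        Finset.card_univ, Fintype.card_fin, nsmul_eq_mul]
    rw [h1, IndepFun.variance_sum (fun i _ => hcu i j) (fun i _ i' _ hii' =>
      (hind.indepFun hii').comp (φ := fun s => ⟪b j, h s⟫) (ψ := fun s => ⟪b j, h s⟫)
        (by fun_prop) (by fun_prop))]
    have h2 : ∀ i, Var[fun ω => ⟪b j, h (u i ω)⟫; P] ≤ ∫ s, ⟪b j, h s - a⟫ ^ 2 ∂γ := by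
      intro i
      have h3 : Var[fun ω => ⟪b j, h (u i ω)⟫; P] = Var[fun s => ⟪b j, h s⟫; γ] := by
        have hh := (hc j).1.aemeasurable
        rw [← (hu i).map_eq] at hh ⊢
        rw [variance_map hh (hu i).aemeasurable]
        rfl
      -- Variance ignores shifts and is at most the second moment about any point, so the centre may
      -- be `a` rather than the biased mean.
      rw [h3, ← variance_sub_const (hc j).1 ⟪b j, a⟫]
      simp only [← inner_sub_right]
      exact variance_le_expectation_sq (by fun_prop)
    calc _ ≤ ∑ _i : Fin N, ∫ s, ⟪b j, h s - a⟫ ^ 2 ∂γ := Finset.sum_le_sum fun i _ => h2 i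
      _ = _ := by simp
  have hL2' : MemLp (fun ω => ∑ i, h (u i ω) - (N : ℝ) • ∫ s, h s ∂γ) 2 P :=
    memLp_sum_sub_of_hasLaw hu hL2 _
  have hL2a : MemLp (fun s => h s - a) 2 γ := hL2.sub (memLp_const a)
  simp_rw [← b.sum_sq_inner_right]
  rw [integral_finsetSum _ fun j _ => (hL2'.const_inner (b j)).integrable_sq,
    integral_finsetSum _ fun j _ => (hL2a.const_inner (b j)).integrable_sq, Finset.mul_sum]
  exact Finset.sum_le_sum fun j _ => hvar j

/-- Chebyshev's inequality for the mean of a vector-valued sample. -/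
theorem measureReal_sample_mean_deviation_le {S Ω : Type*} [MeasurableSpace S]
    [MeasurableSpace Ω] {γ : Measure S} [IsProbabilityMeasure γ] {P : Measure Ω}
    [IsProbabilityMeasure P] {N : ℕ} (hN : 0 < N)
    {u : Fin N → Ω → S} (hu : ∀ i, HasLaw (u i) γ P) (hind : iIndepFun u P)
    {h : S → E} (hm : Measurable h) (hL2 : MemLp h 2 γ) (a : E) {t : ℝ} (ht : 0 < t) :
    P.real {ω | t ≤ ‖(N : ℝ)⁻¹ • ∑ i, h (u i ω) - ∫ s, h s ∂γ‖} ≤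
      (∫ s, ‖h s - a‖ ^ 2 ∂γ) / (N * t ^ 2) := by
  have hN' : (0 : ℝ) < N := Nat.cast_pos.2 hN
  have hL2' : MemLp (fun ω => ∑ i, h (u i ω) - (N : ℝ) • ∫ s, h s ∂γ) 2 P :=
    memLp_sum_sub_of_hasLaw hu hL2 _
  have hset : {ω | t ≤ ‖(N : ℝ)⁻¹ • ∑ i, h (u i ω) - ∫ s, h s ∂γ‖} ⊆
      {ω | (N * t) ^ 2 ≤ ‖∑ i, h (u i ω) - (N : ℝ) • ∫ s, h s ∂γ‖ ^ 2} := by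
    intro ω hω
    have : ∑ i, h (u i ω) - (N : ℝ) • ∫ s, h s ∂γ =
        (N : ℝ) • ((N : ℝ)⁻¹ • ∑ i, h (u i ω) - ∫ s, h s ∂γ) := by
      rw [smul_sub, smul_inv_smul₀ hN'.ne']
    simp only [Set.mem_ofPred_eq] at hω ⊢
    rw [this, norm_smul, Real.norm_of_nonneg hN'.le]
    gcongr
  have h1 := mul_meas_ge_le_integral_of_nonneg (μ := P) (.of_forall fun ω => sq_nonneg _)
    ((memLp_two_iff_integrable_sq_norm hL2'.1).1 hL2') ((N * t) ^ 2)
  rw [le_div_iff₀ (by positivity)]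
  refine le_of_mul_le_mul_left ?_ hN'
  calc (N : ℝ) * (P.real {ω | t ≤ ‖(N : ℝ)⁻¹ • ∑ i, h (u i ω) - ∫ s, h s ∂γ‖} * (N * t ^ 2))
      = (N * t) ^ 2 * P.real {ω | t ≤ ‖(N : ℝ)⁻¹ • ∑ i, h (u i ω) - ∫ s, h s ∂γ‖} := by ring
    _ ≤ _ := mul_le_mul_of_nonneg_left (measureReal_mono hset) (by positivity)
    _ ≤ _ := h1
    _ ≤ _ := integral_norm_sum_sub_sq_le hu hind hm hL2 a

end SampleMean

/-! ### Bias and variance of a perturbed linear sample. -/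

section PerturbedLinear

variable {E : Type*} [NormedAddCommGroup E] [InnerProductSpace ℝ E] [FiniteDimensional ℝ E]
  [MeasurableSpace E] [BorelSpace E]

theorem memLp_two_norm_pow_stdGaussian (k : ℕ) :
    MemLp (fun u : E => ‖u‖ ^ k) 2 (stdGaussian E) := by
  rw [memLp_two_iff_integrable_sq (by fun_prop)]
  simp_rw [← pow_mul]
  exact integrable_norm_pow_stdGaussian _

/-- If `ρ` grows at most like a cubic polynomial, then it is square integrable. -/
theorem memLp_two_of_abs_le {ρ : E → ℝ} (hρ : Measurable ρ) {c e : ℝ}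
    (hb : ∀ u, |ρ u| ≤ c * ‖u‖ ^ 3 + e) : MemLp ρ 2 (stdGaussian E) :=
  (((memLp_two_norm_pow_stdGaussian 3).const_mul c).add (memLp_const e)).mono'
    hρ.aestronglyMeasurable (.of_forall hb)

theorem memLp_two_smul_self_of_abs_le {ρ : E → ℝ} (hρ : Measurable ρ) {c e : ℝ}
    (hb : ∀ u, |ρ u| ≤ c * ‖u‖ ^ 3 + e) : MemLp (fun u => ρ u • u) 2 (stdGaussian E) := by
  refine (((memLp_two_norm_pow_stdGaussian 4).const_mul c).add
    ((memLp_two_norm_pow_stdGaussian 1).const_mul e)).mono' (by fun_prop) (.of_forall fun u => ?_)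
  rw [norm_smul, Real.norm_eq_abs]
  calc |ρ u| * ‖u‖ ≤ (c * ‖u‖ ^ 3 + e) * ‖u‖ := by gcongr; exact hb u
    _ = c * ‖u‖ ^ 4 + e * ‖u‖ ^ 1 := by ring

theorem memLp_two_inner_smul_self (a : E) :
    MemLp (fun u => ⟪a, u⟫ • u) 2 (stdGaussian E) := by
  refine ((memLp_two_norm_pow_stdGaussian 2).const_mul ‖a‖).mono' (by fun_prop)
    (.of_forall fun u => ?_)
  rw [norm_smul, Real.norm_eq_abs]
  calc |⟪a, u⟫| * ‖u‖ ≤ (‖a‖ * ‖u‖) * ‖u‖ := by gcongr; exact abs_real_inner_le_norm a u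
    _ = ‖a‖ * ‖u‖ ^ 2 := by ring

theorem memLp_two_inner_add_smul_self (a : E) {ρ : E → ℝ} (hρ : Measurable ρ) {c e : ℝ}
    (hb : ∀ u, |ρ u| ≤ c * ‖u‖ ^ 3 + e) :
    MemLp (fun u => (⟪a, u⟫ + ρ u) • u) 2 (stdGaussian E) := by
  simp_rw [add_smul]
  exact (memLp_two_inner_smul_self a).add (memLp_two_smul_self_of_abs_le hρ hb)

theorem integral_inner_smul_self_stdGaussian (a : E) :
    ∫ u, ⟪a, u⟫ • u ∂(stdGaussian E) = a := by
  refine ext_inner_left ℝ fun v => ?_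
  rw [← integral_inner ((memLp_two_inner_smul_self a).integrable (by norm_num))]
  simp_rw [inner_smul_right]
  rw [integral_inner_mul_inner_stdGaussian, real_inner_comm]

/-- Bessel's inequality: the coordinates of `u` are orthonormal in L². Testing the mean `v` against
itself and bounding `ρ u * ⟪v, u⟫` by half the sum of squares lets `‖v‖²/2` be absorbed. -/
theorem norm_integral_smul_self_sq_le {ρ : E → ℝ} (hρ : MemLp ρ 2 (stdGaussian E))
    (hρu : Integrable (fun u => ρ u • u) (stdGaussian E)) :
    ‖∫ u, ρ u • u ∂(stdGaussian E)‖ ^ 2 ≤ ∫ u, ρ u ^ 2 ∂(stdGaussian E) := by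
  set v := ∫ u, ρ u • u ∂(stdGaussian E) with hv
  have h1 : ‖v‖ ^ 2 = ∫ u, ⟪v, ρ u • u⟫ ∂(stdGaussian E) := by
    rw [integral_inner hρu, ← hv, real_inner_self_eq_norm_sq]
  have h2 : ∫ u, ⟪v, u⟫ ^ 2 ∂(stdGaussian E) = ‖v‖ ^ 2 := by
    simp_rw [pow_two ⟪v, _⟫]
    rw [integral_inner_mul_inner_stdGaussian, real_inner_self_eq_norm_sq]
  have h3 : ∫ u, ⟪v, ρ u • u⟫ ∂(stdGaussian E) ≤
      ∫ u, (1 / 2) * (ρ u ^ 2 + ⟪v, u⟫ ^ 2) ∂(stdGaussian E) := by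
    refine integral_mono (hρu.const_inner v)
      ((hρ.integrable_sq.add (integrable_inner_pow_stdGaussian v 2)).const_mul _) fun u => ?_
    simp only [inner_smul_right]
    nlinarith [sq_nonneg (ρ u - ⟪v, u⟫)]
  rw [integral_const_mul, integral_add hρ.integrable_sq (integrable_inner_pow_stdGaussian v 2),
    h2] at h3
  linarith

theorem integral_norm_inner_smul_self_sub_sq (a : E) :
    ∫ u, ‖⟪a, u⟫ • u - a‖ ^ 2 ∂(stdGaussian E) = (Module.finrank ℝ E + 1) * ‖a‖ ^ 2 := by
  have h : ∀ u : E, ‖⟪a, u⟫ • u - a‖ ^ 2 =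
      ⟪a, u⟫ ^ 2 * ‖u‖ ^ 2 - 2 * (⟪a, u⟫ * ⟪a, u⟫) + ‖a‖ ^ 2 := by
    intro u
    rw [norm_sub_sq_real, norm_smul, inner_smul_left, real_inner_comm, mul_pow, Real.norm_eq_abs,
      sq_abs]
    simp
  have h4 : Integrable (fun u => ⟪a, u⟫ ^ 2 * ‖u‖ ^ 2) (stdGaussian E) := by
    refine integrable_of_abs_le_norm_pow (by fun_prop) (‖a‖ ^ 2) 4 fun u => ?_
    rw [abs_mul, abs_pow, abs_pow, abs_norm]
    calc |⟪a, u⟫| ^ 2 * ‖u‖ ^ 2 ≤ (‖a‖ * ‖u‖) ^ 2 * ‖u‖ ^ 2 := by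
          gcongr; exact abs_real_inner_le_norm a u
      _ = ‖a‖ ^ 2 * ‖u‖ ^ 4 := by ring
      _ ≤ _ := by gcongr; linarith
  have h2 : Integrable (fun u => ⟪a, u⟫ * ⟪a, u⟫) (stdGaussian E) := by
    simpa only [pow_two] using integrable_inner_pow_stdGaussian a 2
  have h42 : Integrable (fun u => ⟪a, u⟫ ^ 2 * ‖u‖ ^ 2 - 2 * (⟪a, u⟫ * ⟪a, u⟫))
      (stdGaussian E) := h4.sub (h2.const_mul 2)
  simp_rw [h]
  rw [integral_add h42 (integrable_const _),
    integral_sub h4 (h2.const_mul 2), integral_const_mul, integral_inner_mul_inner_stdGaussian,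
    integral_inner_sq_mul_norm_sq_stdGaussian, real_inner_self_eq_norm_sq]
  simp
  ring

theorem integral_norm_inner_add_smul_self_sub_sq_le (a : E) {ρ : E → ℝ}
    (hρu : MemLp (fun u => ρ u • u) 2 (stdGaussian E)) :
    ∫ u, ‖(⟪a, u⟫ + ρ u) • u - a‖ ^ 2 ∂(stdGaussian E) ≤
      2 * ((Module.finrank ℝ E + 1) * ‖a‖ ^ 2) + 2 * ∫ u, ‖ρ u • u‖ ^ 2 ∂(stdGaussian E) := by
  have h1 := integrable_norm_sub_sq (memLp_two_inner_smul_self a) a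
  have h2 := (memLp_two_iff_integrable_sq_norm hρu.1).1 hρu
  rw [← integral_norm_inner_smul_self_sub_sq, ← mul_add, ← integral_add h1 h2,
    ← integral_const_mul]
  refine integral_mono_of_nonneg (.of_forall fun _ => by positivity) ((h1.add h2).const_mul 2)
    (.of_forall fun u => ?_)
  have h3 : (⟪a, u⟫ + ρ u) • u - a = (⟪a, u⟫ • u - a) + ρ u • u := by module
  simp only [h3]
  have h4 := parallelogram_law_with_norm ℝ (⟪a, u⟫ • u - a) (ρ u • u)
  nlinarith [sq_nonneg ‖(⟪a, u⟫ • u - a) - ρ u • u‖]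

theorem integral_sq_le_of_abs_le {ρ : E → ℝ} {c e : ℝ}
    (hb : ∀ u, |ρ u| ≤ c * ‖u‖ ^ 3 + e) :
    ∫ u, ρ u ^ 2 ∂(stdGaussian E) ≤ 30 * c ^ 2 * (Module.finrank ℝ E : ℝ) ^ 3 + 2 * e ^ 2 := by
  have hi := (integrable_norm_pow_stdGaussian (E := E) 6).const_mul (2 * c ^ 2)
  calc ∫ u, ρ u ^ 2 ∂(stdGaussian E)
      ≤ ∫ u, (2 * c ^ 2 * ‖u‖ ^ 6 + 2 * e ^ 2) ∂(stdGaussian E) := by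
        refine integral_mono_of_nonneg (.of_forall fun _ => by positivity)
          (hi.add (integrable_const _)) (.of_forall fun u => ?_)
        have : ρ u ^ 2 ≤ (c * ‖u‖ ^ 3 + e) ^ 2 := sq_le_sq' (abs_le.1 (hb u)).1 (abs_le.1 (hb u)).2
        change ρ u ^ 2 ≤ _
        nlinarith [sq_nonneg (c * ‖u‖ ^ 3 - e)]
    _ = 2 * c ^ 2 * ∫ u, ‖u‖ ^ 6 ∂(stdGaussian E) + 2 * e ^ 2 := by
        rw [integral_add hi (integrable_const _), integral_const_mul]
        simp
    -- `15 = 5‼` from the sixth moment; the eighth moment likewise gives `105 = 7‼`.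
    _ ≤ 2 * c ^ 2 * ((Module.finrank ℝ E : ℝ) ^ 3 * 15) + 2 * e ^ 2 := by
        gcongr
        simpa [Nat.doubleFactorial] using integral_norm_pow_stdGaussian_le (E := E) 2
    _ = _ := by ring

theorem integral_norm_smul_self_sq_le_of_abs_le {ρ : E → ℝ} {c e : ℝ}
    (hb : ∀ u, |ρ u| ≤ c * ‖u‖ ^ 3 + e) :
    ∫ u, ‖ρ u • u‖ ^ 2 ∂(stdGaussian E) ≤
      210 * c ^ 2 * (Module.finrank ℝ E : ℝ) ^ 4 + 2 * e ^ 2 * Module.finrank ℝ E := by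
  have hi := (integrable_norm_pow_stdGaussian (E := E) 8).const_mul (2 * c ^ 2)
  have hi' := (integrable_norm_pow_stdGaussian (E := E) 2).const_mul (2 * e ^ 2)
  calc ∫ u, ‖ρ u • u‖ ^ 2 ∂(stdGaussian E)
      ≤ ∫ u, (2 * c ^ 2 * ‖u‖ ^ 8 + 2 * e ^ 2 * ‖u‖ ^ 2) ∂(stdGaussian E) := by
        refine integral_mono_of_nonneg (.of_forall fun _ => by positivity)
          (hi.add hi') (.of_forall fun u => ?_)
        have h1 : ρ u ^ 2 ≤ (c * ‖u‖ ^ 3 + e) ^ 2 :=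
          sq_le_sq' (abs_le.1 (hb u)).1 (abs_le.1 (hb u)).2
        have h2 : ρ u ^ 2 ≤ 2 * c ^ 2 * ‖u‖ ^ 6 + 2 * e ^ 2 := by
          nlinarith [sq_nonneg (c * ‖u‖ ^ 3 - e)]
        change ‖ρ u • u‖ ^ 2 ≤ _
        rw [norm_smul, mul_pow, Real.norm_eq_abs, sq_abs]
        calc ρ u ^ 2 * ‖u‖ ^ 2 ≤ (2 * c ^ 2 * ‖u‖ ^ 6 + 2 * e ^ 2) * ‖u‖ ^ 2 := by gcongr
          _ = _ := by ring
    _ = 2 * c ^ 2 * ∫ u, ‖u‖ ^ 8 ∂(stdGaussian E)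
          + 2 * e ^ 2 * ∫ u, ‖u‖ ^ 2 ∂(stdGaussian E) := by
        rw [integral_add hi hi', integral_const_mul, integral_const_mul]
    _ ≤ 2 * c ^ 2 * ((Module.finrank ℝ E : ℝ) ^ 4 * 105)
          + 2 * e ^ 2 * Module.finrank ℝ E := by
        gcongr
        · simpa [Nat.doubleFactorial] using integral_norm_pow_stdGaussian_le (E := E) 3
        · simpa [Nat.doubleFactorial] using integral_norm_pow_stdGaussian_le (E := E) 0
    _ = _ := by ring

end PerturbedLinear

/-! ### Quantitative consequences of the hypotheses on `σ` and `N`. -/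

theorem abs_central_quotient_sub_inner_gradient_le {n : ℕ}
    {f φ : EuclideanSpace ℝ (Fin n) → ℝ} {M εf σ : ℝ} (hσ : 0 < σ)
    (hnoise : BoundedNoise f φ εf) (hφ : HasLipschitzHessian φ M)
    (x u : EuclideanSpace ℝ (Fin n)) :
    |(f (x + σ • u) - f (x - σ • u)) / (2 * σ) - ⟪gradient φ x, u⟫| ≤
      M * σ ^ 2 / 6 * ‖u‖ ^ 3 + εf / σ := by
  have h1 := abs_central_difference_sub_le hφ.1 hφ.2 x (σ • u)
  rw [map_smul, smul_eq_mul, ← inner_gradient_left, norm_smul, Real.norm_of_nonneg hσ.le] at h1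
  have h2 := abs_le.1 (hnoise.2 (x + σ • u))
  have h3 := abs_le.1 (hnoise.2 (x - σ • u))
  have h1 := abs_le.1 h1
  have h4 : (f (x + σ • u) - f (x - σ • u)) / (2 * σ) - ⟪gradient φ x, u⟫ =
      (f (x + σ • u) - f (x - σ • u) - 2 * (σ * ⟪gradient φ x, u⟫)) / (2 * σ) := by
    field_simp
  rw [h4, abs_div, abs_of_pos (show 0 < 2 * σ by positivity), div_le_iff₀ (by positivity)]
  have h5 : (M * σ ^ 2 / 6 * ‖u‖ ^ 3 + εf / σ) * (2 * σ) =
      M * (σ * ‖u‖) ^ 3 / 3 + 2 * εf := by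
    field_simp
    ring
  rw [h5, abs_le]
  constructor <;> linarith

theorem centralGSG_eq_inv_smul_sum {n N : ℕ} (f : EuclideanSpace ℝ (Fin n) → ℝ) (σ : ℝ)
    (u : Fin N → EuclideanSpace ℝ (Fin n)) (x : EuclideanSpace ℝ (Fin n)) :
    centralGSG f σ u x =
      (N : ℝ)⁻¹ • ∑ i, ((f (x + σ • u i) - f (x - σ • u i)) / (2 * σ)) • u i := by
  unfold centralGSG
  simp_rw [Finset.smul_sum, smul_smul]
  refine Finset.sum_congr rfl fun i _ => ?_
  congr 1
  rw [one_div, mul_inv, div_eq_mul_inv, div_eq_mul_inv, mul_inv]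
  ring

theorem sampling_bound_mul_ge {n : ℕ} (hn : 1 < n) {N θ δ : ℝ} (hθ0 : 0 < θ) (hδ0 : 0 < δ)
    (hN : 3 * (n : ℝ) / (δ * θ ^ 2) * ((n : ℝ) / (Real.sqrt n - 1) ^ 2)
        + ((n : ℝ) + 6) / (144 * δ) + 1 / (6 * δ) ≤ N) :
    3 * ((n : ℝ) + 1) ≤ N * (δ * θ ^ 2) := by
  have hn' : (1 : ℝ) < n := Nat.one_lt_cast.2 hn
  have hq1 : 1 < Real.sqrt n := Real.lt_sqrt_of_sq_lt (by simpa using hn')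
  have hqn : Real.sqrt n ^ 2 = n := Real.sq_sqrt (by linarith)
  set q := Real.sqrt n
  -- The first term of the sample bound suffices, since `(q² + 1)(q - 1)² ≤ q⁴` for `q > 1`; the
  -- other terms are dropped as nonnegative.
  have h1 : (n : ℝ) + 1 ≤ n * (n / (q - 1) ^ 2) := by
    rw [← mul_div_assoc, le_div_iff₀ (by nlinarith), ← hqn]
    nlinarith [mul_pos (sub_pos.2 hq1) (sub_pos.2 hq1), mul_pos (sub_pos.2 hq1) (sub_pos.2 hn')]
  have h2 : 3 * (n : ℝ) / (δ * θ ^ 2) * (n / (q - 1) ^ 2) ≤ N := by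
    have : 0 ≤ ((n : ℝ) + 6) / (144 * δ) + 1 / (6 * δ) := by positivity
    linarith
  calc 3 * ((n : ℝ) + 1) ≤ 3 * (n * (n / (q - 1) ^ 2)) := by linarith
    _ = 3 * (n : ℝ) / (δ * θ ^ 2) * (n / (q - 1) ^ 2) * (δ * θ ^ 2) := by
      field_simp
    _ ≤ N * (δ * θ ^ 2) := by gcongr

theorem radius_upper_bound {n : ℕ} (hn : 0 < n) {M σ K : ℝ} (hM : 0 < M) (hσ : 0 < σ)
    (h : σ ≤ Real.sqrt (K / (12 * (n : ℝ) ^ (3 / 2 : ℝ) * M))) :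
    M * σ ^ 2 * Real.sqrt n ^ 3 ≤ K / 12 := by
  have hn' : (0 : ℝ) < n := Nat.cast_pos.2 hn
  have h1 : (n : ℝ) ^ (3 / 2 : ℝ) = Real.sqrt n ^ 3 := by
    rw [Real.sqrt_eq_rpow, ← Real.rpow_natCast, ← Real.rpow_mul hn'.le]
    norm_num
  have hq : 0 < Real.sqrt n := Real.sqrt_pos.2 hn'
  have h2 := (Real.le_sqrt' hσ).1 h
  rw [h1, le_div_iff₀ (by positivity)] at h2
  linarith

theorem noise_div_radius_le {n : ℕ} (hn : 0 < n) {M εf σ : ℝ} (hM : 0 < M) (hε : 0 ≤ εf)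
    (hσ : 0 < σ) (h : (εf / (Real.sqrt n * M)) ^ (1 / 3 : ℝ) ≤ σ) :
    εf / σ ≤ Real.sqrt n * (M * σ ^ 2) := by
  have hq : 0 < Real.sqrt n := Real.sqrt_pos.2 (Nat.cast_pos.2 hn)
  have h0 : 0 ≤ εf / (Real.sqrt n * M) := by positivity
  have h1 : ((εf / (Real.sqrt n * M)) ^ (1 / 3 : ℝ)) ^ 3 ≤ σ ^ 3 := by gcongr
  rw [← Real.rpow_natCast, ← Real.rpow_mul h0] at h1
  norm_num at h1
  rw [div_le_iff₀ (by positivity)] at h1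
  rw [div_le_iff₀ hσ]
  linarith

/-- The perturbation coefficients `c` and `e` contribute at most a fixed multiple of `K ^ 2` to the
bias, and of `K ^ 2 * n` to the variance. -/
theorem perturbation_bounds {n q c e K : ℝ} (hn : 2 ≤ n) (hq : 0 ≤ q) (hqn : q ^ 2 = n)
    (hc : 0 ≤ c) (he : 0 ≤ e) (hcK : c * q ^ 3 ≤ K / 6) (heK : e * n ≤ K) :
    30 * c ^ 2 * n ^ 3 + 2 * e ^ 2 ≤ 4 / 3 * K ^ 2 ∧
      210 * c ^ 2 * n ^ 4 + 2 * e ^ 2 * n ≤ 6 * K ^ 2 * (n + 1) := by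
  have hcn : c ^ 2 * n ^ 3 ≤ K ^ 2 / 36 := by
    calc c ^ 2 * n ^ 3 = (c * q ^ 3) ^ 2 := by rw [← hqn]; ring
      _ ≤ (K / 6) ^ 2 := by gcongr
      _ = _ := by ring
  have hen : (e * n) ^ 2 ≤ K ^ 2 := by gcongr
  -- Each use of `n ≥ 2` gains a half: `e²n ≤ K²/2`, then `e² ≤ K²/4`. The bias constant is then
  -- `30/36 + 1/2 = 4/3`.
  have hen' : e ^ 2 * n * 2 ≤ K ^ 2 := by
    calc e ^ 2 * n * 2 ≤ e ^ 2 * n * n := by gcongr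
      _ = (e * n) ^ 2 := by ring
      _ ≤ _ := hen
  have hen2 : e ^ 2 * 2 ≤ e ^ 2 * n := by gcongr
  have hcn' : c ^ 2 * n ^ 3 * n ≤ K ^ 2 / 36 * n := by gcongr
  have hK : 0 ≤ K ^ 2 * n := mul_nonneg (sq_nonneg K) (by linarith)
  constructor <;> linarith [sq_nonneg K]

/-! ### Chebyshev's inequality with a bias allowance, and the main result. -/

section PerturbedLinear

variable {E : Type*} [NormedAddCommGroup E] [InnerProductSpace ℝ E] [FiniteDimensional ℝ E]
  [MeasurableSpace E] [BorelSpace E]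

theorem norm_integral_inner_add_smul_self_sub_sq_le (a : E) {ρ : E → ℝ} (hρ : Measurable ρ)
    {c e : ℝ} (hb : ∀ u, |ρ u| ≤ c * ‖u‖ ^ 3 + e) :
    ‖∫ u, (⟪a, u⟫ + ρ u) • u ∂(stdGaussian E) - a‖ ^ 2 ≤
      30 * c ^ 2 * (Module.finrank ℝ E : ℝ) ^ 3 + 2 * e ^ 2 := by
  have hsm := (memLp_two_smul_self_of_abs_le hρ hb).integrable (by norm_num)
  simp_rw [add_smul]
  rw [integral_add ((memLp_two_inner_smul_self a).integrable (by norm_num)) hsm,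
    integral_inner_smul_self_stdGaussian, add_sub_cancel_left]
  exact (norm_integral_smul_self_sq_le (memLp_two_of_abs_le hρ hb) hsm).trans
    (integral_sq_le_of_abs_le hb)

/-- A sample-mean estimate of `a` from the random vectors `(⟪a, u⟫ + ρ u) • u` with `u` standard
Gaussian. -/
theorem measureReal_gaussian_sample_mean_deviation_le {Ω : Type*} [MeasurableSpace Ω]
    {P : Measure Ω} [IsProbabilityMeasure P] {N : ℕ} (hN : 0 < N) {u : Fin N → Ω → E}
    (hu : ∀ i, HasLaw (u i) (stdGaussian E) P) (hind : iIndepFun u P) (a : E) {ρ : E → ℝ}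
    (hρ : Measurable ρ) {c e : ℝ} (hb : ∀ u, |ρ u| ≤ c * ‖u‖ ^ 3 + e) {b t : ℝ} (hb0 : 0 ≤ b)
    (hbt : b < t) (hcb : 30 * c ^ 2 * (Module.finrank ℝ E : ℝ) ^ 3 + 2 * e ^ 2 ≤ b ^ 2) :
    P.real {ω | t < ‖(N : ℝ)⁻¹ • ∑ i, (⟪a, u i ω⟫ + ρ (u i ω)) • u i ω - a‖} ≤
      (2 * ((Module.finrank ℝ E + 1) * ‖a‖ ^ 2) + 2 * (210 * c ^ 2 * (Module.finrank ℝ E : ℝ) ^ 4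
        + 2 * e ^ 2 * Module.finrank ℝ E)) / (N * (t - b) ^ 2) := by
  have hN' : (0 : ℝ) < N := Nat.cast_pos.2 hN
  have hbias := abs_le_of_sq_le_sq
    ((norm_integral_inner_add_smul_self_sub_sq_le a hρ hb).trans hcb) hb0
  rw [abs_norm] at hbias
  have hvar := (integral_norm_inner_add_smul_self_sub_sq_le a
    (memLp_two_smul_self_of_abs_le hρ hb)).trans
    (add_le_add_right (mul_le_mul_of_nonneg_left (integral_norm_smul_self_sq_le_of_abs_le hb)
      zero_le_two) _)
  have hcheb := measureReal_sample_mean_deviation_le hN hu hind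
    (h := fun v => (⟪a, v⟫ + ρ v) • v) (by fun_prop)
    (memLp_two_inner_add_smul_self a hρ hb) a (sub_pos.2 hbt)
  refine (measureReal_mono fun ω hω => ?_).trans
    (hcheb.trans (div_le_div_of_nonneg_right hvar (by positivity)))
  have h1 := norm_sub_le_norm_sub_add_norm_sub
    ((N : ℝ)⁻¹ • ∑ i, (⟪a, u i ω⟫ + ρ (u i ω)) • u i ω)
    (∫ v, (⟪a, v⟫ + ρ v) • v ∂(stdGaussian E)) a
  rw [Set.mem_ofPred_eq] at hω ⊢
  linarith

end PerturbedLinear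

theorem corollary2p8 {n N : ℕ} (hn : 1 < n)
    (f φ : EuclideanSpace ℝ (Fin n) → ℝ) (hf : Measurable f)
    {M εf σ θ δ : ℝ} (hM : 0 < M) (hσ : 0 < σ)
    (hθ0 : 0 < θ) (hθ1 : θ < 1) (hδ0 : 0 < δ) (hδ1 : δ < 1)
    (hnoise : BoundedNoise f φ εf) (hφ : HasLipschitzHessian φ M)
    {Ω : Type*} [MeasurableSpace Ω] (P : Measure Ω) [IsProbabilityMeasure P]
    (u : Fin N → Ω → EuclideanSpace ℝ (Fin n))
    (hu : ∀ i, HasLaw (u i) (stdGaussian (EuclideanSpace ℝ (Fin n))) P)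
    (hind : iIndepFun u P)
    (x : EuclideanSpace ℝ (Fin n))
    (hN : 3 * (n : ℝ) / (δ * θ ^ 2) * ((n : ℝ) / (Real.sqrt n - 1) ^ 2)
        + ((n : ℝ) + 6) / (144 * δ) + 1 / (6 * δ) ≤ (N : ℝ))
    (hσ_lower : (εf / (Real.sqrt n * M)) ^ (1 / 3 : ℝ) ≤ σ)
    (hσ_upper : σ ≤ Real.sqrt (θ * ‖gradient φ x‖ / (12 * (n : ℝ) ^ (3 / 2 : ℝ) * M)))
    (hgrad : 12 * ((n : ℝ) ^ (7 / 2 : ℝ) * M * εf ^ 2) ^ (1 / 3 : ℝ) / θ ≤ ‖gradient φ x‖) :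
    1 - δ ≤ P.real {ω | NormCondition φ θ x (centralGSG f σ (fun i => u i ω) x)} := by
  have hn0 : 0 < n := by omega
  have hn2 : (2 : ℝ) ≤ n := by exact_mod_cast hn
  set a := gradient φ x
  set K := θ * ‖a‖ / 12 with hK
  have hq : 0 < Real.sqrt n := Real.sqrt_pos.2 (by linarith)
  have hqn : Real.sqrt n ^ 2 = n := Real.sq_sqrt (by linarith)
  have hMσ := radius_upper_bound hn0 hM hσ hσ_upper
  have hεσ := noise_div_radius_le hn0 hM hnoise.1 hσ hσ_lower
  have hNδ := sampling_bound_mul_ge hn hθ0 hδ0 hN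
  -- A positive radius below the upper bound forces a nonzero gradient.
  have hK0 : 0 < K := lt_of_lt_of_le (by positivity) hMσ
  have ha : 0 < ‖a‖ := by
    by_contra! h
    nlinarith
  have hN0 : 0 < N := by
    rcases N.eq_zero_or_pos with h | h
    · subst h
      norm_num at hNδ
      linarith
    · exact h
  set ρ : EuclideanSpace ℝ (Fin n) → ℝ :=
    fun v => (f (x + σ • v) - f (x - σ • v)) / (2 * σ) - ⟪a, v⟫ with hρ_def
  set c := M * σ ^ 2 / 6 with hc_def
  set e := εf / σ
  have he0 : 0 ≤ e := div_nonneg hnoise.1 hσ.le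
  have hc0 : 0 < c := by positivity
  have hb : ∀ v, |ρ v| ≤ c * ‖v‖ ^ 3 + e :=
    abs_central_quotient_sub_inner_gradient_le hσ hnoise hφ x
  have hρ : Measurable ρ := by fun_prop
  have hcK : c * Real.sqrt n ^ 3 ≤ K / 6 := by
    rw [hc_def]
    linarith
  have heK : e * n ≤ K := by
    calc e * n ≤ Real.sqrt n * (M * σ ^ 2) * n := by gcongr
      _ = Real.sqrt n * (M * σ ^ 2) * Real.sqrt n ^ 2 := by rw [hqn]
      _ = M * σ ^ 2 * Real.sqrt n ^ 3 := by ring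
      _ ≤ K := hMσ
  obtain ⟨hbias, hvar⟩ := perturbation_bounds hn2 hq.le hqn hc0.le he0 hcK heK
  have hθa : 0 < θ * ‖a‖ := by positivity
  have hbad := measureReal_gaussian_sample_mean_deviation_le hN0 hu hind a hρ hb
    -- The squared bias is at most `4/3 * K² = (θ‖a‖)²/108`, which fits under `(θ‖a‖/10)²`.
    (b := θ * ‖a‖ / 10) (t := θ * ‖a‖) (by positivity) (by linarith) (by
      rw [finrank_euclideanSpace_fin]
      refine hbias.trans ?_
      rw [hK]
      linarith [sq_nonneg (θ * ‖a‖)])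
  rw [finrank_euclideanSpace_fin] at hbad
  have hKa : K ^ 2 ≤ ‖a‖ ^ 2 / 144 := by
    calc K ^ 2 = θ ^ 2 * (‖a‖ ^ 2 / 144) := by rw [hK]; ring
      _ ≤ 1 * (‖a‖ ^ 2 / 144) := by gcongr; exact pow_le_one₀ hθ0.le hθ1.le
      _ = _ := one_mul _
  have hδ : (2 * (((n : ℝ) + 1) * ‖a‖ ^ 2) + 2 * (210 * c ^ 2 * (n : ℝ) ^ 4 + 2 * e ^ 2 * n)) /
      (N * (θ * ‖a‖ - θ * ‖a‖ / 10) ^ 2) ≤ δ := by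
    rw [div_le_iff₀ (mul_pos (Nat.cast_pos.2 hN0) (pow_pos (by linarith) 2))]
    have h1 : K ^ 2 * ((n : ℝ) + 1) ≤ ‖a‖ ^ 2 / 144 * (n + 1) := by gcongr
    have h2 : 0 ≤ ((n : ℝ) + 1) * ‖a‖ ^ 2 := by positivity
    -- `81/100 = (1 - 1/10)²`. The numerator is at most `(2 + 12/144)(n+1)‖a‖²`, and `2 + 1/12 ≤
    -- 243/100`.
    calc _ ≤ 81 / 100 * (3 * ((n : ℝ) + 1)) * ‖a‖ ^ 2 := by linarith
      _ ≤ 81 / 100 * (N * (δ * θ ^ 2)) * ‖a‖ ^ 2 := by gcongr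
      _ = _ := by ring
  -- Covering the space and using subadditivity, instead of taking complements, requires no
  -- measurability of either event.
  have hcover : (Set.univ : Set Ω) ⊆
      {ω | NormCondition φ θ x (centralGSG f σ (fun i => u i ω) x)} ∪
      {ω | θ * ‖a‖ < ‖(N : ℝ)⁻¹ • ∑ i, (⟪a, u i ω⟫ + ρ (u i ω)) • u i ω - a‖} := by
    intro ω _
    rw [Set.mem_union, or_iff_not_imp_right]
    intro hω
    rw [Set.mem_ofPred_eq, not_lt] at hω
    change ‖centralGSG f σ (fun i => u i ω) x - a‖ ≤ θ * ‖a‖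
    rw [centralGSG_eq_inv_smul_sum]
    simpa only [hρ_def, add_sub_cancel] using hω
  have h1 := (measureReal_mono (μ := P) hcover).trans (measureReal_union_le _ _)
  rw [probReal_univ] at h1
  linarith
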